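/- Let $d \ge 2$ and let $H^2$ be the Drury–Arveson space, i.e. the reproducing kernel Hilbert space of functions on the open unit ball $B_d \subset \mathbb{C}^d$ with kernel $K(z,\omega) = \frac{1}{1-\langle z,\omega\rangle}$, $\langle z,\omega\rangle=\sum_{j=1}^d z_j\overline{\omega_j}$. Let $M_{z_j}$ be the (bounded) operator on $H^2$ of multiplication by the $j$-th coordinate function. Let $\mathcal{M} \subset H^2$ be a nonzero submodule, i.e. a nonzero closed subspace with $M_{z_j}\mathcal{M}\subset\mathcal{M}$ for $j=1,\dots,d$, and let $R_{z_j} = M_{z_j}|_{\mathcal{M}}$, regarded as an operator on the Hilbert space $\mathcal{M}$. Then $I-\sum_{j=1}^d R_{z_j}R_{z_j}^* \ge 0$, so that the defect operator $\Delta = \bigl(I-\sum_{j=1}^d R_{z_j}R_{z_j}^*\bigr)^{1/2}$ is defined, and the rank of $\mathcal{M}$, defined as $\dim \overline{\Delta\mathcal{M}} \in \{0,1,2,\dots\}\cup\{\infty\}$, is infinite if and only if $\mathcal{M}$ has infinite codimension in $H^2$, i.e. $\dim (H^2/\mathcal{M}) = \infty$. -/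

import Mathlib

noncomputable section

open scoped InnerProductSpace ComplexConjugate ComplexOrder

namespace DruryArveson

/-- The open unit ball `B_d` of `ℂ^d` with its Euclidean norm. -/
abbrev Ball (d : ℕ) : Type := Metric.ball (0 : EuclideanSpace ℂ (Fin d)) 1

/-- The scalar kernel `K(z, w) = 1 / (1 - ⟨z, w⟩)` with `⟨z, w⟩ = ∑ j, z j * conj (w j)`.
Mathlib's inner product is conjugate linear in its first argument. -/
def kernelFun {d : ℕ} (z w : Ball d) : ℂ := 1 / (1 - ⟪w.1, z.1⟫_ℂ)

/-- The kernel as an operator-valued matrix, as used by Mathlib's `RKHS`. -/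
def kernelMatrix (d : ℕ) : Matrix (Ball d) (Ball d) (ℂ →L[ℂ] ℂ) :=
  .of fun z w => kernelFun z w • ContinuousLinearMap.id ℂ ℂ

lemma inner_eq_sum {d : ℕ} (z w : Ball d) :
    ⟪w.1, z.1⟫_ℂ = ∑ j, z.1 j * conj (w.1 j) := by
  simp [PiLp.inner_apply]

lemma norm_inner_lt_one {d : ℕ} (z w : Ball d) : ‖⟪w.1, z.1⟫_ℂ‖ < 1 := by
  have hz : ‖z.1‖ < 1 := mem_ball_zero_iff.mp z.2
  have hw : ‖w.1‖ < 1 := mem_ball_zero_iff.mp w.2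
  calc ‖⟪w.1, z.1⟫_ℂ‖ ≤ ‖w.1‖ * ‖z.1‖ := norm_inner_le_norm _ _
    _ < 1 := mul_lt_one_of_nonneg_of_lt_one_left (norm_nonneg _) hw hz.le

lemma kernelFun_mul {d : ℕ} (z w : Ball d) :
    (1 - ⟪w.1, z.1⟫_ℂ) * kernelFun z w = 1 := by
  have h : (1 : ℂ) - ⟪w.1, z.1⟫_ℂ ≠ 0 := by
    intro h
    have h1 := norm_inner_lt_one z w
    rw [← sub_eq_zero.mp h] at h1
    simp at h1
  rw [kernelFun, mul_one_div_cancel h]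

lemma kernelFun_conj {d : ℕ} (z w : Ball d) : conj (kernelFun z w) = kernelFun w z := by
  simp [kernelFun]

lemma hasSum_kernelFun {d : ℕ} (z w : Ball d) :
    HasSum (fun n : ℕ => ⟪w.1, z.1⟫_ℂ ^ n) (kernelFun z w) := by
  have := hasSum_geometric_of_norm_lt_one (norm_inner_lt_one z w)
  simpa [kernelFun] using this

lemma re_sum_pow_nonneg {d : ℕ} (s : Finset (Ball d)) (n : ℕ) (c : Ball d → ℂ) :
    0 ≤ (∑ a ∈ s, ∑ b ∈ s, conj (c a) * c b * ⟪b.1, a.1⟫_ℂ ^ n).re := by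
  induction n generalizing c with
  | zero =>
    have : ∑ a ∈ s, ∑ b ∈ s, conj (c a) * c b * ⟪b.1, a.1⟫_ℂ ^ 0
        = conj (∑ a ∈ s, c a) * ∑ a ∈ s, c a := by
      simp [map_sum, Finset.sum_mul_sum]
    rw [this, ← Complex.normSq_eq_conj_mul_self]
    simpa using Complex.normSq_nonneg _
  | succ n ih =>
    have : ∑ a ∈ s, ∑ b ∈ s, conj (c a) * c b * ⟪b.1, a.1⟫_ℂ ^ (n + 1)
        = ∑ l, ∑ a ∈ s, ∑ b ∈ s, conj (c a * conj (a.1 l)) * (c b * conj (b.1 l))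
          * ⟪b.1, a.1⟫_ℂ ^ n := by
      rw [Finset.sum_comm (s := Finset.univ)]
      refine Finset.sum_congr rfl fun a _ => ?_
      rw [Finset.sum_comm (s := Finset.univ)]
      refine Finset.sum_congr rfl fun b _ => ?_
      rw [pow_succ]
      nth_rewrite 2 [inner_eq_sum]
      simp only [Finset.mul_sum, map_mul, RingHomCompTriple.comp_apply, RingHom.id_apply]
      refine Finset.sum_congr rfl fun l _ => ?_
      ring
    rw [this, Complex.re_sum]
    exact Finset.sum_nonneg fun l _ => ih _

lemma re_sum_kernelFun_nonneg {d : ℕ} (s : Finset (Ball d)) (c : Ball d → ℂ) :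
    0 ≤ (∑ a ∈ s, ∑ b ∈ s, conj (c a) * c b * kernelFun a b).re := by
  have h : HasSum (fun n : ℕ => ∑ a ∈ s, ∑ b ∈ s, conj (c a) * c b * ⟪b.1, a.1⟫_ℂ ^ n)
      (∑ a ∈ s, ∑ b ∈ s, conj (c a) * c b * kernelFun a b) :=
    hasSum_sum fun a _ => hasSum_sum fun b _ => (hasSum_kernelFun a b).mul_left _
  exact (Complex.hasSum_re h).nonneg fun n => re_sum_pow_nonneg s n c

theorem posSemidef_kernelMatrix (d : ℕ) : (kernelMatrix d).PosSemidef := by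
  have htfae := (RKHS.posSemidef_tfae (K := kernelMatrix d)).out 0 2
  refine htfae.mpr ⟨?_, fun v => ?_⟩
  · ext z w
    simp [Matrix.conjTranspose_apply, kernelMatrix, star_smul, kernelFun_conj,
      show star (ContinuousLinearMap.id ℂ ℂ) = ContinuousLinearMap.id ℂ ℂ from star_one _]
  · have h := re_sum_kernelFun_nonneg v.support (fun x => v x)
    simp only [Finsupp.sum]
    refine h.trans_eq (congrArg Complex.re ?_)
    refine Finset.sum_congr rfl fun a _ => Finset.sum_congr rfl fun b _ => ?_
    simp only [kernelMatrix, Matrix.of_apply, FunLike.coe_smul, Pi.smul_apply,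
      ContinuousLinearMap.id_apply, smul_eq_mul, RCLike.inner_apply, map_mul, kernelFun_conj]
    ring

instance (d : ℕ) : Fact (kernelMatrix d).PosSemidef := ⟨posSemidef_kernelMatrix d⟩

/-- The Drury–Arveson space `H²` over `B_d`: the reproducing kernel Hilbert space of functions
`B_d → ℂ` with kernel `1 / (1 - ⟨z, w⟩)`. The value of `f : H2 d` at `z` is written `f z`. -/
abbrev H2 (d : ℕ) : Type := RKHS.OfKernel (kernelMatrix d)

lemma kerFun_inner_kerFun {d : ℕ} (z w : Ball d) :
    ⟪RKHS.kerFun (H2 d) z 1, RKHS.kerFun (H2 d) w 1⟫_ℂ = kernelFun z w := by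
  rw [RKHS.kerFun_inner, RKHS.kerFun_apply, RKHS.OfKernel.kernel_ofKernel]
  simp [kernelMatrix]

/-- The finite combinations `c ↦ ∑ w, c w • K(·, w)` of kernel functions. -/
def kernelCombination (d : ℕ) : (Ball d →₀ ℂ) →ₗ[ℂ] H2 d :=
  Finsupp.linearCombination ℂ fun w => RKHS.kerFun (H2 d) w 1

/-- `c ↦ ∑ w, c w * conj (w j) • K(·, w)`. -/
def weightedCombination (d : ℕ) (j : Fin d) : (Ball d →₀ ℂ) →ₗ[ℂ] H2 d :=
  Finsupp.linearCombination ℂ fun w => conj (w.1 j) • RKHS.kerFun (H2 d) w 1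

lemma denseRange_kernelCombination (d : ℕ) : DenseRange (kernelCombination d) := by
  have h := RKHS.kerFun_dense (H := H2 d)
  rw [← Submodule.dense_iff_topologicalClosure_eq_top] at h
  refine h.mono ?_
  rw [← LinearMap.coe_range, SetLike.coe_subset_coe, Submodule.span_le]
  rintro _ ⟨x, v, rfl⟩
  refine ⟨Finsupp.single x v, ?_⟩
  simp only [kernelCombination, Finsupp.linearCombination_single]
  rw [← map_smul]
  simp

lemma inner_sum_kerFun {d : ℕ} (s : Finset (Ball d)) (c : Ball d → ℂ) :
    ⟪∑ w ∈ s, c w • RKHS.kerFun (H2 d) w 1, ∑ w ∈ s, c w • RKHS.kerFun (H2 d) w 1⟫_ℂ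
      = ∑ a ∈ s, ∑ b ∈ s, conj (c a) * c b * kernelFun a b := by
  rw [sum_inner]
  simp only [inner_sum, inner_smul_left, inner_smul_right, kerFun_inner_kerFun]
  refine Finset.sum_congr rfl fun a _ => Finset.sum_congr rfl fun b _ => ?_
  ring

lemma norm_weightedCombination_le {d : ℕ} (j : Fin d) (c : Ball d →₀ ℂ) :
    ‖weightedCombination d j c‖ ≤ 1 * ‖kernelCombination d c‖ := by
  set s := c.support
  have hw (l : Fin d) : weightedCombination d l c
      = ∑ w ∈ s, (c w * conj (w.1 l)) • RKHS.kerFun (H2 d) w 1 := by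
    simp [weightedCombination, Finsupp.linearCombination_apply, Finsupp.sum, s, mul_smul]
  have hk : kernelCombination d c = ∑ w ∈ s, c w • RKHS.kerFun (H2 d) w 1 := by
    simp [kernelCombination, Finsupp.linearCombination_apply, Finsupp.sum, s]
  have key : ⟪kernelCombination d c, kernelCombination d c⟫_ℂ
      = conj (∑ a ∈ s, c a) * (∑ a ∈ s, c a)
        + ∑ l, ⟪weightedCombination d l c, weightedCombination d l c⟫_ℂ := by
    simp only [hk, hw, inner_sum_kerFun]
    rw [map_sum, Finset.sum_mul_sum, Finset.sum_comm (s := Finset.univ), ← Finset.sum_add_distrib]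
    refine Finset.sum_congr rfl fun a _ => ?_
    rw [Finset.sum_comm (s := Finset.univ), ← Finset.sum_add_distrib]
    refine Finset.sum_congr rfl fun b _ => ?_
    have h : ∑ l, conj (c a * conj (a.1 l)) * (c b * conj (b.1 l)) * kernelFun a b
        = conj (c a) * c b * (⟪b.1, a.1⟫_ℂ * kernelFun a b) := by
      rw [inner_eq_sum, Finset.sum_mul, Finset.mul_sum]
      refine Finset.sum_congr rfl fun l _ => ?_
      simp only [map_mul, RingHomCompTriple.comp_apply, RingHom.id_apply]
      ring
    rw [h]
    linear_combination ((conj (c a) * c b)) * kernelFun_mul a b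
  have key2 : ‖kernelCombination d c‖ ^ 2
      = Complex.normSq (∑ a ∈ s, c a) + ∑ l, ‖weightedCombination d l c‖ ^ 2 := by
    have := congrArg Complex.re key
    rw [← Complex.normSq_eq_conj_mul_self, Complex.add_re, Complex.re_sum] at this
    simpa only [inner_self_eq_norm_sq_to_K, ← Complex.ofReal_pow, Complex.ofReal_re,
      Complex.coe_algebraMap] using this
  have h1 : ‖weightedCombination d j c‖ ^ 2 ≤ ∑ l, ‖weightedCombination d l c‖ ^ 2 :=
    Finset.single_le_sum (f := fun l => ‖weightedCombination d l c‖ ^ 2)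
      (fun l _ => sq_nonneg _) (Finset.mem_univ j)
  have h2 := Complex.normSq_nonneg (∑ a ∈ s, c a)
  rw [one_mul]
  exact (sq_le_sq₀ (norm_nonneg _) (norm_nonneg _)).mp (by linarith)

theorem exists_mulCoord {d : ℕ} (j : Fin d) :
    ∃ T : H2 d →L[ℂ] H2 d, ∀ (f : H2 d) (z : Ball d), T f z = z.1 j * f z := by
  let A : H2 d →L[ℂ] H2 d :=
    (weightedCombination d j).extendOfNorm (kernelCombination d)
  have hA (z : Ball d) : A (RKHS.kerFun (H2 d) z 1)
      = conj (z.1 j) • RKHS.kerFun (H2 d) z 1 := by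
    have := LinearMap.extendOfNorm_eq (denseRange_kernelCombination d)
      ⟨1, norm_weightedCombination_le j⟩ (Finsupp.single z 1)
    simpa [kernelCombination, weightedCombination, A] using this
  refine ⟨A.adjoint, fun f z => ?_⟩
  have h := RKHS.kerFun_inner z (1 : ℂ) (A.adjoint f)
  rw [ContinuousLinearMap.adjoint_inner_right, hA, inner_smul_left, RKHS.kerFun_inner] at h
  simpa using h.symm

/-- The bounded operator `M_{z_j}` of multiplication by the `j`-th coordinate function on `H²`.
It is determined by `mulCoord_apply`. -/
def mulCoord {d : ℕ} (j : Fin d) : H2 d →L[ℂ] H2 d := (exists_mulCoord j).choose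

lemma mulCoord_apply {d : ℕ} (j : Fin d) (f : H2 d) (z : Ball d) :
    mulCoord j f z = z.1 j * f z := (exists_mulCoord j).choose_spec f z

/-- A closed subspace of `H²` is a submodule if it is invariant under all `M_{z_j}`. -/
def IsInvariant {d : ℕ} (M : ClosedSubmodule ℂ (H2 d)) : Prop :=
  ∀ j : Fin d, ∀ f ∈ M.toSubmodule, mulCoord j f ∈ M.toSubmodule

instance {d : ℕ} (M : ClosedSubmodule ℂ (H2 d)) : CompleteSpace M.toSubmodule :=
  M.isClosed.completeSpace_coe

/-- The restrictions `R_{z_j} = M_{z_j} | M` to a submodule, as operators on the Hilbert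
space `M`. -/
def restrictedTuple {d : ℕ} (M : ClosedSubmodule ℂ (H2 d)) (hM : IsInvariant M) (j : Fin d) :
    M.toSubmodule →L[ℂ] M.toSubmodule :=
  (mulCoord j).restrict (hM j)

section Tuple

variable {d : ℕ} {E : Type*} [NormedAddCommGroup E] [InnerProductSpace ℂ E] [CompleteSpace E]

/-- `I - ∑ j, T_j T_j^*`. -/
def defectSq (T : Fin d → E →L[ℂ] E) : E →L[ℂ] E :=
  1 - ∑ j, T j ∘L (T j).adjoint

/-- A tuple of operators is `d`-contractive if `I - ∑ j, T_j T_j^* ≥ 0`. -/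
def IsDContractive (T : Fin d → E →L[ℂ] E) : Prop := (defectSq T).IsPositive

/-- The defect operator `Δ = (I - ∑ j, T_j T_j^*)^{1/2}` of a `d`-contractive tuple. -/
def defectOperator (T : Fin d → E →L[ℂ] E) : E →L[ℂ] E := CFC.sqrt (defectSq T)

/-- The rank of a `d`-contractive tuple on `E`: the dimension of the closure of `Δ E`, as an
element of `ℕ ∪ {∞}`. -/
def tupleRank (T : Fin d → E →L[ℂ] E) : ℕ∞ :=
  Cardinal.toENat (Module.rank ℂ (defectOperator T).range.topologicalClosure)

end Tuple

end DruryArveson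

end

/-!
Write `M_j` for `mulCoord j`, `P` for the orthogonal projection onto the submodule `M`, and
`S = ∑ j, M_j^* M_j`.

Since `I - ∑ j, M_j M_j^*` is the projection onto the constants, the square of the defect operator
of `M` is a sum of squares: with `e` the evaluation at `0` on `M` and `B_j` the part of `M_j^*` that
maps `M` to its orthogonal complement, it equals `e^* e + ∑ j, B_j^* B_j` (`defectSq_eq`). This
gives positivity, and finite rank if `M` has finite codimension. Conversely, if `M` has finite rank
then so do all `B_j`, that is, `P` commutes with every `M_j` and `M_j^*`, hence with `S`, modulo
finite rank operators.

The homogeneous polynomials of degree `n` form the eigenspace of `S` for the eigenvalue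
`(n + d) / (n + 1)`, and for `d ≥ 2` these eigenvalues are distinct. If `M` contained no nonzero
homogeneous polynomial, then `P` would map the polynomials of degree `n` onto a space on which
`S - (n + d) / (n + 1)` is injective with values in the range of the fixed finite rank operator
`S P - P S`, so that the degree `n` components of elements of `M` would span a space of dimension
bounded in `n` (`finrank_map_starProjection_le`). But these components contain the product of a fixed nonzero
polynomial with all binary forms of degree `n - l`, whose dimension is unbounded. So `M` contains a
homogeneous polynomial `q ≠ 0` (`exists_homogeneous_mem`). Multiplication `T` by `q` is injective,
maps `H²` into `M`, and has a finite rank commutator `T P - P T = -T (I - P)`; hence `I - P` has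
finite rank (`isFiniteRank_one_sub_starProjection`).
-/

noncomputable section

open scoped InnerProductSpace ComplexConjugate ComplexOrder

namespace DruryArveson

/-! ### Finite rank operators -/

section FiniteRank

variable {E F G : Type*} [NormedAddCommGroup E] [InnerProductSpace ℂ E]
  [NormedAddCommGroup F] [InnerProductSpace ℂ F] [NormedAddCommGroup G] [InnerProductSpace ℂ G]

/-- A bounded operator has finite rank if its range is finite-dimensional. -/
def IsFiniteRank (A : E →L[ℂ] F) : Prop := A.range.FG

lemma isFiniteRank_iff_cofg_ker {A : E →L[ℂ] F} : IsFiniteRank A ↔ A.ker.CoFG :=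
  Submodule.range_fg_iff_ker_cofg

lemma IsFiniteRank.of_ker_le {A : E →L[ℂ] F} {B : E →L[ℂ] G} (hA : IsFiniteRank A)
    (h : A.ker ≤ B.ker) : IsFiniteRank B :=
  isFiniteRank_iff_cofg_ker.2 (.of_le h (isFiniteRank_iff_cofg_ker.1 hA))

lemma isFiniteRank_zero : IsFiniteRank (0 : E →L[ℂ] F) :=
  isFiniteRank_iff_cofg_ker.2 (.of_le (fun x _ => by simp) .top)

lemma IsFiniteRank.add {A B : E →L[ℂ] F} (hA : IsFiniteRank A) (hB : IsFiniteRank B) :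
    IsFiniteRank (A + B) := by
  rw [isFiniteRank_iff_cofg_ker] at *
  refine .of_le (fun x hx => ?_) (hA.inf hB)
  simp_all

lemma IsFiniteRank.neg {A : E →L[ℂ] F} (hA : IsFiniteRank A) : IsFiniteRank (-A) :=
  hA.of_ker_le fun x hx => by simp_all

lemma isFiniteRank_sum {ι : Type*} (s : Finset ι) {A : ι → E →L[ℂ] F}
    (h : ∀ i ∈ s, IsFiniteRank (A i)) : IsFiniteRank (∑ i ∈ s, A i) :=
  Finset.sum_induction _ IsFiniteRank (fun _ _ => .add) isFiniteRank_zero h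

lemma IsFiniteRank.comp_left {A : E →L[ℂ] F} (hA : IsFiniteRank A) (B : F →L[ℂ] G) :
    IsFiniteRank (B ∘L A) :=
  hA.of_ker_le fun x hx => by simp_all

lemma IsFiniteRank.comp_right {A : F →L[ℂ] G} (hA : IsFiniteRank A) (B : E →L[ℂ] F) :
    IsFiniteRank (A ∘L B) := by
  refine Submodule.FG.of_le hA ?_
  rintro _ ⟨x, rfl⟩
  exact ⟨B x, rfl⟩

lemma IsFiniteRank.adjoint [CompleteSpace E] [CompleteSpace F] {A : E →L[ℂ] F}
    (hA : IsFiniteRank A) : IsFiniteRank A.adjoint := by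
  have : FiniteDimensional ℂ A.range := .of_fg hA
  refine (Submodule.FG.map (A.adjoint : F →ₗ[ℂ] E) hA).of_le ?_
  rintro _ ⟨y, rfl⟩
  refine ⟨A.range.starProjection y, Submodule.starProjection_apply_mem _ _, ?_⟩
  have h : A.adjoint (y - A.range.starProjection y) = 0 := by
    refine ext_inner_left ℂ fun x => ?_
    rw [ContinuousLinearMap.adjoint_inner_right, inner_zero_right]
    exact Submodule.inner_right_of_mem_orthogonal (K := A.range) ⟨x, rfl⟩
      (Submodule.sub_starProjection_mem_orthogonal y)
  rw [map_sub, sub_eq_zero] at h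
  exact h.symm

lemma IsFiniteRank.of_isSelfAdjoint_mul_self [CompleteSpace E] {A : E →L[ℂ] E}
    (h : IsSelfAdjoint A) (hA : IsFiniteRank (A * A)) : IsFiniteRank A := by
  refine hA.of_ker_le fun x hx => ?_
  have hx : A (A x) = 0 := hx
  have : ⟪A x, A x⟫_ℂ = 0 := by
    rw [← ContinuousLinearMap.adjoint_inner_right, h.adjoint_eq, hx, inner_zero_right]
  exact inner_self_eq_zero.1 this

/-- The rank of a `d`-contractive tuple is infinite exactly when the square of its defect
operator fails to have finite rank. -/
lemma tupleRank_eq_top_iff {d : ℕ} [CompleteSpace E] {T : Fin d → E →L[ℂ] E}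
    (hT : IsDContractive T) : tupleRank T = ⊤ ↔ ¬ IsFiniteRank (defectSq T) := by
  have h0 : 0 ≤ defectSq T := (ContinuousLinearMap.nonneg_iff_isPositive _).2 hT
  have hsq : defectOperator T * defectOperator T = defectSq T :=
    CFC.sqrt_mul_sqrt_self _ h0
  have hsa : IsSelfAdjoint (defectOperator T) := .of_nonneg (CFC.sqrt_nonneg _)
  rw [tupleRank, Cardinal.toENat_eq_top, ← not_lt, not_iff_not, Module.rank_lt_aleph0_iff]
  constructor
  · intro h
    have : IsFiniteRank (defectOperator T) :=
      (Module.Finite.iff_fg.1 h).of_le (Submodule.le_topologicalClosure _)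
    rw [← hsq]
    exact this.comp_left _
  · intro h
    have h1 : IsFiniteRank (defectOperator T) :=
      .of_isSelfAdjoint_mul_self hsa (by rwa [hsq])
    have : FiniteDimensional ℂ (defectOperator T).range := .of_fg h1
    rw [(Submodule.closed_of_finiteDimensional _).submodule_topologicalClosure_eq]
    exact this

end FiniteRank

/-! ### The row contraction and the homogeneous kernel functions -/

variable {d : ℕ}

/-- The kernel function `K(·, w)` as an element of `H²`. -/
def kerVec (w : Ball d) : H2 d := RKHS.kerFun (H2 d) w 1

/-- The constant function `1`, realised as the kernel function at the origin. -/
def oneVec (d : ℕ) : H2 d := kerVec ⟨0, by simp⟩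

lemma inner_kerVec (w : Ball d) (f : H2 d) : ⟪kerVec w, f⟫_ℂ = f w := by
  simp [kerVec]

lemma kerVec_apply (w z : Ball d) : kerVec w z = kernelFun z w := by
  rw [← inner_kerVec, kerVec, kerVec, kerFun_inner_kerFun]

lemma oneVec_apply (z : Ball d) : oneVec d z = 1 := by
  simp [oneVec, kerVec_apply, kernelFun]

lemma inner_oneVec (f : H2 d) : ⟪oneVec d, f⟫_ℂ = f ⟨0, by simp⟩ := inner_kerVec _ _

lemma dense_span_kerVec : Dense (Submodule.span ℂ (Set.range (kerVec (d := d))) : Set (H2 d)) := by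
  refine (denseRange_kernelCombination d).mono ?_
  rintro _ ⟨c, rfl⟩
  exact Submodule.sum_mem _ fun w _ => Submodule.smul_mem _ _ (Submodule.subset_span ⟨w, rfl⟩)

lemma adjoint_mulCoord_kerVec (j : Fin d) (w : Ball d) :
    (mulCoord j).adjoint (kerVec w) = conj (w.1 j) • kerVec w := by
  refine ext_inner_right ℂ fun f => ?_
  rw [ContinuousLinearMap.adjoint_inner_left, inner_kerVec, inner_smul_left, inner_kerVec,
    mulCoord_apply]
  simp

lemma mulCoord_comm (i j : Fin d) : Commute (mulCoord (d := d) i) (mulCoord j) := by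
  ext f z
  simp only [mul_apply_eq_comp, mulCoord_apply]
  ring

/-- `I - ∑ j, M_j M_j^*` is the orthogonal projection onto the constants. -/
lemma sub_sum_mulCoord_adjoint (f : H2 d) :
    f - ∑ j, mulCoord j ((mulCoord j).adjoint f) = ⟪oneVec d, f⟫_ℂ • oneVec d := by
  have h : (1 - ∑ j, mulCoord j ∘L (mulCoord j).adjoint : H2 d →L[ℂ] H2 d)
      = (innerSL ℂ (oneVec d)).smulRight (oneVec d) := by
    refine ContinuousLinearMap.ext_on dense_span_kerVec ?_
    rintro _ ⟨w, rfl⟩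
    ext z
    rw [sub_apply, sum_apply]
    simp only [one_apply_eq_self, ContinuousLinearMap.comp_apply,
      adjoint_mulCoord_kerVec, ContinuousLinearMap.smulRight_apply, innerSL_apply_apply,
      inner_oneVec]
    rw [← inner_kerVec, inner_sub_right, inner_sum]
    simp only [inner_kerVec, map_smul, RKHS.coe_smul, Pi.smul_apply, smul_eq_mul, mulCoord_apply,
      oneVec_apply, kerVec_apply]
    have h1 := kernelFun_mul z w
    rw [inner_eq_sum] at h1
    have h2 : kernelFun (⟨0, by simp⟩ : Ball d) w = 1 := by simp [kernelFun]
    rw [h2, mul_one, ← h1, sub_mul, one_mul, Finset.sum_mul]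
    exact congrArg _ (Finset.sum_congr rfl fun j _ => by ring)
  simpa [sum_apply] using congrArg (fun A => A f) h

lemma inner_eq_add_sum_adjoint (f g : H2 d) :
    ⟪f, g⟫_ℂ = ⟪f, oneVec d⟫_ℂ * ⟪oneVec d, g⟫_ℂ
      + ∑ j, ⟪(mulCoord j).adjoint f, (mulCoord j).adjoint g⟫_ℂ := by
  have h := congrArg (fun x => ⟪f, x⟫_ℂ) (sub_sum_mulCoord_adjoint g)
  have h1 (j : Fin d) : ⟪f, mulCoord j ((mulCoord j).adjoint g)⟫_ℂ
      = ⟪(mulCoord j).adjoint f, (mulCoord j).adjoint g⟫_ℂ :=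
    (ContinuousLinearMap.adjoint_inner_left _ _ _).symm
  simp only [inner_sub_right, inner_sum, inner_smul_right, h1] at h
  rw [sub_eq_iff_eq_add.1 h, mul_comm]

lemma sum_norm_adjoint_sq_le (f : H2 d) : ∑ j, ‖(mulCoord j).adjoint f‖ ^ 2 ≤ ‖f‖ ^ 2 := by
  have h := inner_eq_add_sum_adjoint f f
  simp only [inner_self_eq_norm_sq_to_K] at h
  rw [← inner_conj_symm f, RCLike.conj_mul] at h
  have h' : ‖f‖ ^ 2 = ‖⟪oneVec d, f⟫_ℂ‖ ^ 2 + ∑ j, ‖(mulCoord j).adjoint f‖ ^ 2 := by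
    exact_mod_cast h
  rw [h']
  exact le_add_of_nonneg_left (sq_nonneg _)

/-- The operator of multiplication by the linear form `z ↦ ∑ j, z j * conj (w j)`. -/
def mulLin (w : Fin d → ℂ) : H2 d →L[ℂ] H2 d := ∑ j, conj (w j) • mulCoord j

lemma mulLin_apply (w : Fin d → ℂ) (f : H2 d) :
    mulLin w f = ∑ j, conj (w j) • mulCoord j f := by
  simp [mulLin]

lemma mulLin_apply_apply (w z : Ball d) (f : H2 d) :
    mulLin w.1 f z = ⟪w.1, z.1⟫_ℂ * f z := by
  rw [mulLin_apply, ← inner_kerVec, inner_sum, inner_eq_sum, Finset.sum_mul]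
  refine Finset.sum_congr rfl fun j _ => ?_
  rw [inner_smul_right, inner_kerVec, mulCoord_apply]
  ring

lemma mulLin_smul (t : ℂ) (w : Fin d → ℂ) : mulLin (t • w) = conj t • mulLin w := by
  simp [mulLin, Finset.smul_sum, mul_smul]

lemma adjoint_mulLin (w : Fin d → ℂ) (f : H2 d) :
    (mulLin w).adjoint f = ∑ j, w j • (mulCoord j).adjoint f := by
  simp [mulLin, map_sum, map_smulₛₗ]

/-- The tuple `M_z` is a row contraction, so `z ↦ ⟨z, w⟩` has multiplier norm at most `‖w‖`. -/
lemma norm_mulLin_le (w : EuclideanSpace ℂ (Fin d)) : ‖mulLin w.ofLp‖ ≤ ‖w‖ := by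
  rw [← LinearIsometryEquiv.norm_map ContinuousLinearMap.adjoint]
  refine ContinuousLinearMap.opNorm_le_bound _ (norm_nonneg _) fun f => ?_
  rw [adjoint_mulLin]
  calc ‖∑ j, w j • (mulCoord j).adjoint f‖ ≤ ∑ j, ‖w j‖ * ‖(mulCoord j).adjoint f‖ :=
        (norm_sum_le _ _).trans_eq (Finset.sum_congr rfl fun j _ => norm_smul _ _)
    _ ≤ √(∑ j, ‖w j‖ ^ 2) * √(∑ j, ‖(mulCoord j).adjoint f‖ ^ 2) :=
        Real.sum_mul_le_sqrt_mul_sqrt _ _ _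
    _ ≤ ‖w‖ * ‖f‖ := by
        rw [← EuclideanSpace.norm_eq]
        gcongr
        exact (Real.sqrt_le_sqrt (sum_norm_adjoint_sq_le f)).trans_eq (Real.sqrt_sq (norm_nonneg _))

/-- Division by `1 - ⟨z, w⟩` is given by a Neumann series. -/
lemma hasSum_mulLin_pow (w : Ball d) {x y : H2 d} (h : x - mulLin w.1 x = y) :
    HasSum (fun n => (mulLin w.1 ^ n) y) x := by
  have hw : ‖mulLin w.1.ofLp‖ < 1 :=
    (norm_mulLin_le w.1).trans_lt (mem_ball_zero_iff.mp w.2)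
  have h1 := (summable_geometric_of_norm_lt_one hw).hasSum
  have h2 := h1.mapL (ContinuousLinearMap.apply ℂ (H2 d) y)
  have h3 := congrArg (fun A => A x) (geom_series_mul_neg _ hw)
  simp only [mul_apply_eq_comp, sub_apply,
    one_apply_eq_self, h] at h3
  simpa [h3] using h2

lemma sub_mulLin_kerVec (w : Ball d) : kerVec w - mulLin w.1 (kerVec w) = oneVec d := by
  ext z
  simp only [RKHS.coe_sub, Pi.sub_apply, mulLin_apply_apply, kerVec_apply, oneVec_apply]
  rw [← kernelFun_mul z w]
  ring

/-- The homogeneous polynomial `z ↦ ⟨z, w⟩ ^ n`, the degree `n` component of `K(·, w)`. -/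
def homVec (n : ℕ) (w : Fin d → ℂ) : H2 d := (mulLin w ^ n) (oneVec d)

lemma hasSum_homVec (w : Ball d) : HasSum (fun n => homVec n w.1.ofLp) (kerVec w) :=
  hasSum_mulLin_pow w (sub_mulLin_kerVec w)

lemma homVec_succ (n : ℕ) (w : Fin d → ℂ) :
    homVec (n + 1) w = mulLin w (homVec n w) := by
  simp [homVec, pow_succ']

lemma homVec_smul (n : ℕ) (t : ℂ) (w : Fin d → ℂ) :
    homVec n (t • w) = conj t ^ n • homVec n w := by
  simp [homVec, mulLin_smul, smul_pow]

/-- The inner product with `homVec n w` evaluates the degree `n` homogeneous component at `w`. -/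
lemma hasSum_inner_homVec (w : Ball d) (f : H2 d) :
    HasSum (fun n => ⟪homVec n w.1.ofLp, f⟫_ℂ) (f w) := by
  have h := (hasSum_homVec w).mapL (innerSL ℂ f)
  simp only [innerSL_apply_apply] at h
  exact Complex.hasSum_conj'.1 (by simpa [inner_conj_symm, ← inner_kerVec w f] using h)

lemma eq_zero_of_inner_homVec {f : H2 d} (h : ∀ n w, ⟪homVec n w, f⟫_ℂ = 0) : f = 0 := by
  ext w
  have := hasSum_inner_homVec w f
  simp only [h] at this
  simpa using this.unique hasSum_zero

/-- The coefficients of a convergent power series with values in `H²` are unique. -/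
lemma eq_of_hasSum_pow_smul {c c' : ℕ → H2 d} {g : ℂ → H2 d}
    (h : ∀ᶠ s in nhds (0 : ℂ), HasSum (fun n => s ^ n • c n) (g s))
    (h' : ∀ᶠ s in nhds (0 : ℂ), HasSum (fun n => s ^ n • c' n) (g s)) : c = c' := by
  let p (c : ℕ → H2 d) : FormalMultilinearSeries ℂ ℂ (H2 d) :=
    fun n => ContinuousMultilinearMap.mkPiRing ℂ (Fin n) (c n)
  have hp (c : ℕ → H2 d) (n : ℕ) : (p c).coeff n = c n := by
    simp [p, FormalMultilinearSeries.coeff]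
  have h1 : HasFPowerSeriesAt g (p c) 0 := hasFPowerSeriesAt_iff.2 (by simpa [hp] using h)
  have h2 : HasFPowerSeriesAt g (p c') 0 := hasFPowerSeriesAt_iff.2 (by simpa [hp] using h')
  funext n
  rw [← hp c, ← hp c', h1.eq_formalMultilinearSeries h2]

/-- Comparison of coefficients in `M_j^* K(·, w) = conj (w j) K(·, w)` along the complex disc
through `w`. -/
lemma adjoint_mulCoord_homVec_of_mem_ball (j : Fin d) (n : ℕ) (w : Ball d) :
    (mulCoord j).adjoint (homVec (n + 1) w.1.ofLp) = conj (w.1 j) • homVec n w.1.ofLp := by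
  let c (n : ℕ) : H2 d := (mulCoord j).adjoint (homVec n w.1.ofLp)
  let c' (n : ℕ) : H2 d := n.casesOn 0 fun n => conj (w.1 j) • homVec n w.1.ofLp
  suffices c = c' from congrFun this (n + 1)
  have hball : ∀ᶠ s in nhds (0 : ℂ), ‖s‖ < 1 := by
    filter_upwards [Metric.ball_mem_nhds (0 : ℂ) one_pos] with s hs
    simpa using hs
  have hmem (s : ℂ) (hs : ‖s‖ < 1) :
      conj s • w.1 ∈ Metric.ball (0 : EuclideanSpace ℂ (Fin d)) 1 := by
    have hw : ‖w.1‖ < 1 := mem_ball_zero_iff.mp w.2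
    rw [mem_ball_zero_iff, norm_smul, RCLike.norm_conj]
    exact mul_lt_one_of_nonneg_of_lt_one_left (norm_nonneg _) hs hw.le
  -- The expansion of the kernel function along the disc through `w`.
  have hs (s : ℂ) (hs : ‖s‖ < 1) :
      HasSum (fun n => s ^ n • homVec n w.1.ofLp) (kerVec ⟨conj s • w.1, hmem s hs⟩) := by
    simpa [homVec_smul] using hasSum_homVec ⟨conj s • w.1, hmem s hs⟩
  refine eq_of_hasSum_pow_smul
    (g := fun s => if hs : ‖s‖ < 1 then
      (mulCoord j).adjoint (kerVec ⟨conj s • w.1, hmem s hs⟩) else 0) ?_ ?_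
  · filter_upwards [hball] with s h1
    rw [dif_pos h1]
    simpa [c] using (hs s h1).mapL (mulCoord j).adjoint
  · filter_upwards [hball] with s h1
    rw [dif_pos h1, adjoint_mulCoord_kerVec, ← hasSum_nat_add_iff' 1]
    have := (hs s h1).const_smul (s * conj (w.1 j))
    simp only [Finset.range_one, Finset.sum_singleton, c']
    convert this using 2 with n
    · simp only [smul_smul]
      ring_nf
    · simp

/-- `M_j^*` maps `⟨z, w⟩ ^ (n + 1)` to `conj (w j) ⟨z, w⟩ ^ n`. -/
lemma adjoint_mulCoord_homVec_succ (j : Fin d) (n : ℕ) (w : Fin d → ℂ) :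
    (mulCoord j).adjoint (homVec (n + 1) w) = conj (w j) • homVec n w := by
  -- Both sides are homogeneous in `w`, so it suffices to treat a multiple of `w` in the ball.
  obtain ⟨r, v, rfl⟩ : ∃ r : ℂ, ∃ v : Ball d, w = r • v.1.ofLp := by
    have hpos : 0 < ‖WithLp.toLp 2 w‖ + 1 := by positivity
    have hne : ((‖WithLp.toLp 2 w‖ + 1 : ℝ) : ℂ) ≠ 0 := by exact_mod_cast hpos.ne'
    refine ⟨((‖WithLp.toLp 2 w‖ + 1 : ℝ) : ℂ),
      ⟨((‖WithLp.toLp 2 w‖ + 1 : ℝ) : ℂ)⁻¹ • WithLp.toLp 2 w, ?_⟩, ?_⟩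
    · rw [mem_ball_zero_iff, norm_smul, norm_inv, Complex.norm_real, Real.norm_of_nonneg hpos.le,
        inv_mul_lt_one₀ hpos]
      exact lt_add_one _
    · rw [WithLp.ofLp_smul, smul_smul, mul_inv_cancel₀ hne, one_smul]
  rw [homVec_smul, homVec_smul, map_smul, adjoint_mulCoord_homVec_of_mem_ball]
  simp only [Pi.smul_apply, smul_eq_mul, map_mul, smul_smul]
  ring_nf

lemma inner_homVec_succ_mulCoord (j : Fin d) (n : ℕ) (w : Fin d → ℂ) (f : H2 d) :
    ⟪homVec (n + 1) w, mulCoord j f⟫_ℂ = w j * ⟪homVec n w, f⟫_ℂ := by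
  rw [← ContinuousLinearMap.adjoint_inner_left, adjoint_mulCoord_homVec_succ, inner_smul_left]
  simp

/-! ### Homogeneous polynomials as eigenvectors of the sum of the operators `M_j^* M_j` -/

lemma hasDerivAt_add_smul_pow {R : Type*} [NormedRing R] [NormedAlgebra ℂ R] {a b : R}
    (h : Commute a b) (n : ℕ) :
    HasDerivAt (fun s : ℂ => (a + s • b) ^ (n + 1)) ((n + 1 : ℂ) • (b * a ^ n)) 0 := by
  have h1 : HasDerivAt (fun s : ℂ => a + s • b) b 0 := by
    simpa using ((hasDerivAt_id (0 : ℂ)).smul_const b).const_add a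
  induction n with
  | zero => simpa using h1
  | succ n ih =>
    have := ih.mul h1
    simp only [zero_smul, add_zero] at this
    refine (this.congr_deriv ?_).congr_of_eventuallyEq (.of_forall fun s => ?_)
    · rw [smul_mul_assoc, mul_assoc, ← pow_succ, (h.pow_left (n + 1)).eq]
      push_cast
      module
    · simp [pow_succ]

lemma mulLin_commute (w : Fin d → ℂ) (j : Fin d) : Commute (mulLin w) (mulCoord j) :=
  .sum_left _ _ _ fun i _ => (mulCoord_comm i j).smul_left _

/-- Polarization: `⟨z, w⟩ ^ n * z_j` is a derivative of `⟨z, w⟩ ^ (n + 1)` in `w`. Since `homVec` is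
conjugate linear in `w`, the increment is `conj s` to make it holomorphic in `s`. -/
lemma hasDerivAt_homVec (n : ℕ) (w : Fin d → ℂ) (j : Fin d) :
    HasDerivAt (fun s : ℂ => homVec (n + 1) (w + conj s • Pi.single j 1))
      ((n + 1 : ℂ) • mulCoord j (homVec n w)) 0 := by
  have h := (hasDerivAt_add_smul_pow (mulLin_commute w j) n).hasFDerivAt
  have h1 := ((ContinuousLinearMap.apply ℂ (H2 d) (oneVec d)).hasFDerivAt.comp _ h).hasDerivAt
  have hlin (s : ℂ) : mulLin (w + conj s • Pi.single j 1) = mulLin w + s • mulCoord j := by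
    simp [mulLin, add_smul, Finset.sum_add_distrib, Pi.single_apply, apply_ite (starRingEnd ℂ)]
  refine (h1.congr_deriv ?_).congr_of_eventuallyEq (.of_forall fun s => ?_)
  · simp [homVec]
  · simp [homVec, hlin]

/-- The operator `∑ j, M_j^* M_j`. -/
def sumAdjMul (d : ℕ) : H2 d →L[ℂ] H2 d := ∑ j, (mulCoord j).adjoint ∘L mulCoord j

lemma sumAdjMul_apply (f : H2 d) :
    sumAdjMul d f = ∑ j, (mulCoord j).adjoint (mulCoord j f) := by
  simp [sumAdjMul]

lemma inner_sumAdjMul (f g : H2 d) : ⟪sumAdjMul d f, g⟫_ℂ = ⟪f, sumAdjMul d g⟫_ℂ := by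
  simp only [sumAdjMul_apply, sum_inner, inner_sum, ContinuousLinearMap.adjoint_inner_left,
    ContinuousLinearMap.adjoint_inner_right]

lemma hasDerivAt_conj_add_single (i j : Fin d) (w : Fin d → ℂ) :
    HasDerivAt (fun s : ℂ => conj ((w + conj s • Pi.single j 1 : Fin d → ℂ) i))
      (if i = j then 1 else 0) 0 := by
  by_cases hij : i = j
  · subst hij
    simpa using (hasDerivAt_id (0 : ℂ)).const_add (conj (w i))
  · simpa [hij] using hasDerivAt_const (0 : ℂ) (conj (w i))

lemma adjoint_mulCoord_mulCoord_one (i j : Fin d) :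
    (mulCoord i).adjoint (mulCoord j (oneVec d)) = (if i = j then (1 : ℂ) else 0) • oneVec d := by
  have h1 := (mulCoord i).adjoint.hasFDerivAt.comp_hasDerivAt _
    (hasDerivAt_homVec 0 (0 : Fin d → ℂ) j)
  have h2 := (hasDerivAt_conj_add_single i j 0).smul_const (oneVec d)
  have := h1.unique (h2.congr_of_eventuallyEq (.of_forall fun s => by
    rw [Function.comp_apply, adjoint_mulCoord_homVec_succ]
    simp [homVec]))
  simpa [homVec] using this

/-- The derivative, in the direction of the `j`-th unit vector, of the identity
`M_i^* ⟨z, w⟩ ^ (n + 2) = conj (w i) ⟨z, w⟩ ^ (n + 1)`. -/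
lemma smul_adjoint_mulCoord_mulCoord_homVec (i j : Fin d) (n : ℕ) (w : Fin d → ℂ) :
    (n + 2 : ℂ) • (mulCoord i).adjoint (mulCoord j (homVec (n + 1) w))
      = (if i = j then (1 : ℂ) else 0) • homVec (n + 1) w
        + (n + 1 : ℂ) • conj (w i) • mulCoord j (homVec n w) := by
  have h1 := (mulCoord i).adjoint.hasFDerivAt.comp_hasDerivAt _ (hasDerivAt_homVec (n + 1) w j)
  have h2 := (hasDerivAt_conj_add_single i j w).smul (hasDerivAt_homVec n w j)
  have := h1.unique (h2.congr_of_eventuallyEq (.of_forall fun s => by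
    simp [adjoint_mulCoord_homVec_succ]))
  simp only [map_smul, map_zero, zero_smul, add_zero] at this
  push_cast at this
  rw [show (n + 2 : ℂ) = n + 1 + 1 by ring, this, add_comm, smul_comm]

/-- The homogeneous polynomials of degree `n` are eigenvectors of `∑ j, M_j^* M_j` for the
eigenvalue `(n + d) / (n + 1)`. -/
lemma smul_sumAdjMul_homVec (n : ℕ) (w : Fin d → ℂ) :
    (n + 1 : ℂ) • sumAdjMul d (homVec n w) = (n + d : ℂ) • homVec n w := by
  cases n with
  | zero => simp [sumAdjMul_apply, homVec, adjoint_mulCoord_mulCoord_one, Nat.cast_smul_eq_nsmul]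
  | succ n =>
    have h : ∑ i, conj (w i) • mulCoord i (homVec n w) = homVec (n + 1) w := by
      rw [homVec_succ, mulLin_apply]
    rw [sumAdjMul_apply, Finset.smul_sum]
    push_cast
    simp only [show (n + 1 + 1 : ℂ) = n + 2 by ring, smul_adjoint_mulCoord_mulCoord_homVec,
      if_true, one_smul, Finset.sum_add_distrib, ← Finset.smul_sum, h, Finset.sum_const,
      Finset.card_univ, Fintype.card_fin, ← Nat.cast_smul_eq_nsmul ℂ]
    module

/-- The eigenvalue of `∑ j, M_j^* M_j` on the homogeneous polynomials of degree `n`. -/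
def homEigenvalue (d n : ℕ) : ℝ := (n + d) / (n + 1)

lemma sumAdjMul_homVec (n : ℕ) (w : Fin d → ℂ) :
    sumAdjMul d (homVec n w) = (homEigenvalue d n : ℂ) • homVec n w := by
  have hn : (n + 1 : ℂ) ≠ 0 := by exact_mod_cast n.succ_ne_zero
  refine smul_right_injective _ hn ?_
  change (n + 1 : ℂ) • _ = (n + 1 : ℂ) • _
  rw [smul_sumAdjMul_homVec, smul_smul]
  congr 1
  simp only [homEigenvalue]
  push_cast
  field_simp

/-- This is where `d ≥ 2` is essential: for `d = 1` all the eigenvalues equal `1`. -/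
lemma homEigenvalue_injective (hd : 2 ≤ d) : Function.Injective (homEigenvalue d) := by
  intro m n h
  rw [homEigenvalue, homEigenvalue, div_eq_div_iff (by positivity) (by positivity)] at h
  have hd' : (d : ℝ) - 1 ≠ 0 := by
    have : (2 : ℝ) ≤ d := by exact_mod_cast hd
    linarith
  have : ((d : ℝ) - 1) * (m - n) = 0 := by linarith
  exact_mod_cast sub_eq_zero.1 ((mul_eq_zero.1 this).resolve_left hd')

lemma inner_homVec_eq_zero_of_eigenvector (hd : 2 ≤ d) {n m : ℕ} (hmn : m ≠ n) {f : H2 d}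
    (hf : sumAdjMul d f = (homEigenvalue d n : ℂ) • f) (w : Fin d → ℂ) :
    ⟪homVec m w, f⟫_ℂ = 0 := by
  have h := inner_sumAdjMul (homVec m w) f
  rw [sumAdjMul_homVec, hf, inner_smul_left, inner_smul_right, Complex.conj_ofReal] at h
  refine (mul_eq_mul_right_iff.1 h).resolve_left fun h => hmn ?_
  exact homEigenvalue_injective hd (by exact_mod_cast h)

/-- An eigenvector of `∑ j, M_j^* M_j` for the degree `n` eigenvalue is homogeneous of
degree `n`. -/
lemma apply_eq_inner_homVec_of_eigenvector (hd : 2 ≤ d) {n : ℕ} {f : H2 d}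
    (hf : sumAdjMul d f = (homEigenvalue d n : ℂ) • f) (w : Ball d) :
    f w = ⟪homVec n w.1.ofLp, f⟫_ℂ :=
  (hasSum_inner_homVec w f).unique <| hasSum_single n fun _ hm =>
    inner_homVec_eq_zero_of_eigenvector hd hm hf _

/-- The homogeneous component of degree `n` of any `f` in `H²` is a polynomial `q`, and
multiplication by `q` is an operator in the algebra generated by the `M_j`, which multiplies
homogeneous components by `q`. -/
lemma exists_multiplier (n : ℕ) (f : H2 d) :
    ∃ q : MvPolynomial (Fin d) ℂ, ∃ T ∈ Algebra.adjoin ℂ (Set.range (mulCoord (d := d))),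
      (∀ w, ⟪homVec n w, f⟫_ℂ = MvPolynomial.eval w q) ∧
      (∀ g z, T g z = MvPolynomial.eval z.1.ofLp q * g z) ∧
      ∀ l w g, ⟪homVec (n + l) w, T g⟫_ℂ = MvPolynomial.eval w q * ⟪homVec l w, g⟫_ℂ := by
  induction n generalizing f with
  | zero =>
    refine ⟨.C ⟪oneVec d, f⟫_ℂ, algebraMap ℂ _ ⟪oneVec d, f⟫_ℂ, Subalgebra.algebraMap_mem _ _,
      fun w => by simp [homVec], fun g z => ?_, fun l w g => ?_⟩
    · simp [Algebra.algebraMap_eq_smul_one]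
    · simp [Algebra.algebraMap_eq_smul_one, inner_smul_right]
  | succ n ih =>
    choose q T hT hq hTq hTl using fun j => ih ((mulCoord j).adjoint f)
    refine ⟨∑ j, .X j * q j, ∑ j, mulCoord j * T j, sum_mem fun j _ =>
      mul_mem (Algebra.subset_adjoin ⟨j, rfl⟩) (hT j), fun w => ?_, fun g z => ?_, fun l w g => ?_⟩
    · rw [homVec_succ, mulLin_apply, sum_inner, map_sum]
      refine Finset.sum_congr rfl fun j _ => ?_
      rw [inner_smul_left, ← ContinuousLinearMap.adjoint_inner_right, hq]
      simp
    · rw [← inner_kerVec, sum_apply, inner_sum, map_sum, Finset.sum_mul]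
      refine Finset.sum_congr rfl fun j _ => ?_
      simp [inner_kerVec, mulCoord_apply, hTq, mul_assoc]
    · rw [sum_apply, inner_sum, map_sum, Finset.sum_mul, Nat.add_right_comm]
      refine Finset.sum_congr rfl fun j _ => ?_
      simp [inner_homVec_succ_mulCoord, hTl, mul_assoc]

lemma exists_eval_eq_inner_homVec (n : ℕ) (f : H2 d) :
    ∃ q : MvPolynomial (Fin d) ℂ, ∀ w, ⟪homVec n w, f⟫_ℂ = MvPolynomial.eval w q :=
  let ⟨q, _, _, hq, _⟩ := exists_multiplier n f
  ⟨q, hq⟩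

/-! ### Commutators with the projection onto a submodule -/

section Commutators

variable {E : Type*} [NormedAddCommGroup E] [InnerProductSpace ℂ E] {P A B : E →L[ℂ] E}

/-- The commutator of `A` and `P` has finite rank. -/
def CommutesModFiniteRank (P A : E →L[ℂ] E) : Prop := IsFiniteRank (A * P - P * A)

lemma CommutesModFiniteRank.add (hA : CommutesModFiniteRank P A)
    (hB : CommutesModFiniteRank P B) : CommutesModFiniteRank P (A + B) := by
  have := IsFiniteRank.add hA hB
  rwa [show A * P - P * A + (B * P - P * B) = (A + B) * P - P * (A + B) by noncomm_ring] at this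

lemma CommutesModFiniteRank.mul (hA : CommutesModFiniteRank P A)
    (hB : CommutesModFiniteRank P B) : CommutesModFiniteRank P (A * B) := by
  have := (hA.comp_right B).add (hB.comp_left A)
  rwa [← ContinuousLinearMap.mul_def, ← ContinuousLinearMap.mul_def,
    show (A * P - P * A) * B + A * (B * P - P * B) = A * B * P - P * (A * B) by noncomm_ring]
    at this

lemma commutesModFiniteRank_of_commute (h : Commute A P) : CommutesModFiniteRank P A := by
  rw [CommutesModFiniteRank, h.eq, sub_self]
  exact isFiniteRank_zero

lemma CommutesModFiniteRank.sum {ι : Type*} (s : Finset ι) {A : ι → E →L[ℂ] E}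
    (h : ∀ i ∈ s, CommutesModFiniteRank P (A i)) : CommutesModFiniteRank P (∑ i ∈ s, A i) :=
  Finset.sum_induction _ (CommutesModFiniteRank P) (fun _ _ => .add)
    (commutesModFiniteRank_of_commute (.zero_left P)) h

lemma CommutesModFiniteRank.adjoint [CompleteSpace E] (hP : IsSelfAdjoint P)
    (hA : CommutesModFiniteRank P A) : CommutesModFiniteRank P A.adjoint := by
  have := (IsFiniteRank.adjoint hA).neg
  rw [← ContinuousLinearMap.star_eq_adjoint] at *
  simpa [CommutesModFiniteRank, hP.star_eq] using this

/-- The operators that commute with `P` modulo finite rank operators form an algebra. -/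
lemma CommutesModFiniteRank.of_mem_adjoin {s : Set (E →L[ℂ] E)}
    (hs : ∀ A ∈ s, CommutesModFiniteRank P A) (hA : A ∈ Algebra.adjoin ℂ s) :
    CommutesModFiniteRank P A := by
  induction hA using Algebra.adjoin_induction with
  | mem A hA => exact hs A hA
  | algebraMap r => exact commutesModFiniteRank_of_commute (Algebra.commutes r P)
  | add _ _ _ _ hA hB => exact hA.add hB
  | mul _ _ _ _ hA hB => exact hA.mul hB

end Commutators

section Submodules

variable {M : ClosedSubmodule ℂ (H2 d)}

/-- The evaluation functional `f ↦ f 0` on a submodule. -/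
def evalZeroOn (M : ClosedSubmodule ℂ (H2 d)) : M.toSubmodule →L[ℂ] ℂ :=
  innerSL ℂ (oneVec d) ∘L M.toSubmodule.subtypeL

/-- The off-diagonal part of `M_j^*` which maps a submodule into its orthogonal complement. -/
def offDiagAdjoint (M : ClosedSubmodule ℂ (H2 d)) (j : Fin d) : M.toSubmodule →L[ℂ] H2 d :=
  (1 - M.toSubmodule.starProjection) ∘L (mulCoord j).adjoint ∘L M.toSubmodule.subtypeL

lemma inner_eq_inner_starProjection_add {E : Type*} [NormedAddCommGroup E]
    [InnerProductSpace ℂ E] (K : Submodule ℂ E) [K.HasOrthogonalProjection] (x y : E) :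
    ⟪x, y⟫_ℂ = ⟪K.orthogonalProjectionOnto x, K.orthogonalProjectionOnto y⟫_ℂ
      + ⟪x - K.starProjection x, y - K.starProjection y⟫_ℂ := by
  have h (u v : E) : ⟪K.starProjection u, v - K.starProjection v⟫_ℂ = 0 :=
    Submodule.inner_right_of_mem_orthogonal (Submodule.starProjection_apply_mem _ _)
      (Submodule.sub_starProjection_mem_orthogonal v)
  have h1 := h x y
  have h2 : ⟪x - K.starProjection x, K.starProjection y⟫_ℂ = 0 := by
    rw [← inner_conj_symm, h, map_zero]
  rw [Submodule.coe_inner, Submodule.coe_orthogonalProjectionOnto_apply,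
    Submodule.coe_orthogonalProjectionOnto_apply]
  rw [inner_sub_right] at h1
  rw [inner_sub_right, h2, inner_sub_left]
  linear_combination h1

lemma adjoint_restrictedTuple (hM : IsInvariant M) (j : Fin d) (f : M.toSubmodule) :
    (restrictedTuple M hM j).adjoint f
      = M.toSubmodule.orthogonalProjectionOnto ((mulCoord j).adjoint (f : H2 d)) := by
  refine ext_inner_right ℂ fun g => ?_
  rw [ContinuousLinearMap.adjoint_inner_left, Submodule.inner_orthogonalProjectionOnto_eq_of_mem_right,
    ContinuousLinearMap.adjoint_inner_left]
  rfl

/-- The square of the defect operator is a sum of squares, built from evaluation at the origin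
and the off-diagonal parts of the `M_j^*`. -/
lemma defectSq_eq (hM : IsInvariant M) :
    defectSq (restrictedTuple M hM) = (evalZeroOn M).adjoint ∘L evalZeroOn M
      + ∑ j, (offDiagAdjoint M j).adjoint ∘L offDiagAdjoint M j := by
  ext1 f
  refine ext_inner_right ℂ fun g => ?_
  set R := restrictedTuple M hM
  have hL : ⟪defectSq R f, g⟫_ℂ
      = ⟪(f : H2 d), (g : H2 d)⟫_ℂ - ∑ j, ⟪(R j).adjoint f, (R j).adjoint g⟫_ℂ := by
    simp only [defectSq, sub_apply, sum_apply, one_apply_eq_self, ContinuousLinearMap.comp_apply,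
      inner_sub_left, sum_inner, ContinuousLinearMap.adjoint_inner_right, Submodule.coe_inner]
  have hR : ⟪((evalZeroOn M).adjoint ∘L evalZeroOn M
      + ∑ j, (offDiagAdjoint M j).adjoint ∘L offDiagAdjoint M j) f, g⟫_ℂ
      = ⟪(f : H2 d), oneVec d⟫_ℂ * ⟪oneVec d, (g : H2 d)⟫_ℂ
        + ∑ j, ⟪offDiagAdjoint M j f, offDiagAdjoint M j g⟫_ℂ := by
    simp only [add_apply, sum_apply, ContinuousLinearMap.comp_apply, inner_add_left, sum_inner,
      ContinuousLinearMap.adjoint_inner_left]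
    simp [evalZeroOn, mul_comm]
  have hj (j : Fin d) : ⟪(mulCoord j).adjoint (f : H2 d), (mulCoord j).adjoint (g : H2 d)⟫_ℂ
      = ⟪(R j).adjoint f, (R j).adjoint g⟫_ℂ + ⟪offDiagAdjoint M j f, offDiagAdjoint M j g⟫_ℂ := by
    rw [inner_eq_inner_starProjection_add M.toSubmodule, adjoint_restrictedTuple,
      adjoint_restrictedTuple]
    rfl
  have hsum := Finset.sum_congr (s₁ := Finset.univ) rfl fun j _ => hj j
  rw [Finset.sum_add_distrib] at hsum
  have hfg := inner_eq_add_sum_adjoint (f : H2 d) (g : H2 d)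
  rw [hsum] at hfg
  have aux {a b x y s t : ℂ} (h1 : a = x - s) (h2 : b = y + t) (h3 : x = y + (s + t)) : a = b := by
    rw [h1, h2, h3]
    ring
  exact aux hL hR hfg

lemma isDContractive_restrictedTuple (hM : IsInvariant M) :
    IsDContractive (restrictedTuple M hM) := by
  rw [IsDContractive, defectSq_eq]
  exact (ContinuousLinearMap.isPositive_adjoint_comp_self _).add
    (ContinuousLinearMap.isPositive_sum _ fun j _ =>
      ContinuousLinearMap.isPositive_adjoint_comp_self _)

lemma isFiniteRank_offDiagAdjoint (hM : IsInvariant M)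
    (h : IsFiniteRank (defectSq (restrictedTuple M hM))) (j : Fin d) :
    IsFiniteRank (offDiagAdjoint M j) := by
  refine h.of_ker_le fun f hf => ?_
  have hf : defectSq (restrictedTuple M hM) f = 0 := hf
  have h0 := congrArg (fun g => RCLike.re ⟪g, f⟫_ℂ) hf
  rw [defectSq_eq] at h0
  simp only [add_apply, sum_apply, ContinuousLinearMap.comp_apply, inner_add_left, sum_inner,
    ContinuousLinearMap.adjoint_inner_left, inner_zero_left, map_add, map_sum, map_zero,
    inner_self_eq_norm_sq] at h0
  have h1 : ‖offDiagAdjoint M j f‖ ^ 2 ≤ 0 := by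
    rw [← h0]
    exact (Finset.single_le_sum (f := fun i => ‖offDiagAdjoint M i f‖ ^ 2)
      (fun i _ => sq_nonneg _) (Finset.mem_univ j)).trans (le_add_of_nonneg_left (sq_nonneg _))
  simpa using h1

lemma mulCoord_starProjection_mem (hM : IsInvariant M) (j : Fin d) (f : H2 d) :
    mulCoord j (M.toSubmodule.starProjection f) ∈ M.toSubmodule :=
  hM j _ (Submodule.starProjection_apply_mem _ _)

/-- For a submodule of finite rank, the projection onto it commutes with each `M_j` modulo
finite rank operators. -/
lemma commutesModFiniteRank_mulCoord (hM : IsInvariant M)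
    (h : IsFiniteRank (defectSq (restrictedTuple M hM))) (j : Fin d) :
    CommutesModFiniteRank M.toSubmodule.starProjection (mulCoord j) := by
  set P := M.toSubmodule.starProjection
  have hP : IsSelfAdjoint P := isSelfAdjoint_starProjection _
  have h1 : P * (mulCoord j * P) = mulCoord j * P := by
    ext1 f
    exact Submodule.starProjection_eq_self_iff.2 (mulCoord_starProjection_mem hM j f)
  have h2 := congrArg star h1
  simp only [star_mul, hP.star_eq] at h2
  have h3 : CommutesModFiniteRank P (mulCoord j).adjoint := by
    have := (isFiniteRank_offDiagAdjoint hM h j).comp_right M.toSubmodule.orthogonalProjectionOnto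
    rw [ContinuousLinearMap.star_eq_adjoint] at h2
    rw [CommutesModFiniteRank, ← h2]
    exact this
  simpa using h3.adjoint hP

lemma commutesModFiniteRank_sumAdjMul (hM : IsInvariant M)
    (h : IsFiniteRank (defectSq (restrictedTuple M hM))) :
    CommutesModFiniteRank M.toSubmodule.starProjection (sumAdjMul d) :=
  .sum _ fun j _ => ((commutesModFiniteRank_mulCoord hM h j).adjoint
    (isSelfAdjoint_starProjection _)).mul (commutesModFiniteRank_mulCoord hM h j)

lemma isFiniteRank_one_sub_starProjection_iff :
    IsFiniteRank (1 - M.toSubmodule.starProjection) ↔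
      FiniteDimensional ℂ (H2 d ⧸ M.toSubmodule) := by
  rw [isFiniteRank_iff_cofg_ker]
  have : (1 - M.toSubmodule.starProjection : H2 d →L[ℂ] H2 d).ker = M.toSubmodule := by
    ext f
    change f - M.toSubmodule.starProjection f = 0 ↔ f ∈ M.toSubmodule
    rw [sub_eq_zero, eq_comm, Submodule.starProjection_eq_self_iff]
  rw [this]

lemma isFiniteRank_defectSq (hM : IsInvariant M)
    (h : FiniteDimensional ℂ (H2 d ⧸ M.toSubmodule)) :
    IsFiniteRank (defectSq (restrictedTuple M hM)) := by
  rw [defectSq_eq]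
  refine .add ?_ (isFiniteRank_sum _ fun j _ => ?_)
  · have : IsFiniteRank (evalZeroOn M) := IsNoetherian.noetherian _
    exact this.comp_left _
  · exact ((isFiniteRank_one_sub_starProjection_iff.2 h).comp_right _).comp_left _

end Submodules

/-! ### Homogeneous polynomials in submodules of finite rank -/

lemma inner_homVec_add_mulCoord_pow (j : Fin d) (k l : ℕ) (w : Fin d → ℂ) (f : H2 d) :
    ⟪homVec (k + l) w, (mulCoord j ^ k) f⟫_ℂ = w j ^ k * ⟪homVec l w, f⟫_ℂ := by
  induction k with
  | zero => simp
  | succ k ih =>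
    rw [Nat.add_right_comm, pow_succ', mul_apply_eq_comp, inner_homVec_succ_mulCoord, ih]
    ring

lemma mulCoord_pow_mem {M : ClosedSubmodule ℂ (H2 d)} (hM : IsInvariant M) (j : Fin d) (k : ℕ)
    {f : H2 d} (hf : f ∈ M.toSubmodule) : (mulCoord j ^ k) f ∈ M.toSubmodule := by
  induction k with
  | zero => simpa using hf
  | succ k ih =>
    rw [pow_succ', mul_apply_eq_comp]
    exact hM j _ ih

lemma mulLin_mem {M : ClosedSubmodule ℂ (H2 d)} (hM : IsInvariant M) (w : Fin d → ℂ)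
    {f : H2 d} (hf : f ∈ M.toSubmodule) : mulLin w f ∈ M.toSubmodule := by
  rw [mulLin_apply]
  exact Submodule.sum_mem _ fun j _ => Submodule.smul_mem _ _ (hM j f hf)

/-- If `M` contains no nonzero homogeneous polynomial of degree `n`, then the projection onto `M`
maps the homogeneous polynomials of degree `n` onto a space whose dimension is bounded
independently of `n`: on that image `∑ j, M_j^* M_j - (n + d) / (n + 1)` is injective, with values
in the range of the commutator. -/
lemma finrank_map_starProjection_le {M : ClosedSubmodule ℂ (H2 d)} {n : ℕ}
    (hS : CommutesModFiniteRank M.toSubmodule.starProjection (sumAdjMul d))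
    (hn : ∀ q ∈ M.toSubmodule, sumAdjMul d q = (homEigenvalue d n : ℂ) • q → q = 0) :
    Module.Finite ℂ ((Submodule.span ℂ (Set.range (homVec (d := d) n))).map
        (M.toSubmodule.starProjection : H2 d →ₗ[ℂ] H2 d)) ∧
    Module.finrank ℂ ((Submodule.span ℂ (Set.range (homVec (d := d) n))).map
        (M.toSubmodule.starProjection : H2 d →ₗ[ℂ] H2 d)) ≤
      Module.finrank ℂ (sumAdjMul d * M.toSubmodule.starProjection
        - M.toSubmodule.starProjection * sumAdjMul d).range := by
  set P := M.toSubmodule.starProjection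
  set X := sumAdjMul d * P - P * sumAdjMul d
  set V := Submodule.span ℂ (Set.range (homVec (d := d) n))
  have : FiniteDimensional ℂ X.range := .of_fg hS
  have hV : ∀ v ∈ V, sumAdjMul d v = (homEigenvalue d n : ℂ) • v := by
    intro v hv
    have hle : V ≤ (sumAdjMul d - (homEigenvalue d n : ℂ) • (1 : H2 d →L[ℂ] H2 d)).ker := by
      rw [Submodule.span_le]
      rintro _ ⟨w, rfl⟩
      change sumAdjMul d (homVec n w) - (homEigenvalue d n : ℂ) • homVec n w = 0
      rw [sumAdjMul_homVec, sub_self]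
    exact sub_eq_zero.1 (hle hv)
  let A : H2 d →ₗ[ℂ] H2 d :=
    (sumAdjMul d - (homEigenvalue d n : ℂ) • (1 : H2 d →L[ℂ] H2 d) : H2 d →L[ℂ] H2 d)
  have hA (f : H2 d) : A f = sumAdjMul d f - (homEigenvalue d n : ℂ) • f := rfl
  have hAX : ∀ y ∈ V.map (P : H2 d →ₗ[ℂ] H2 d), A y ∈ X.range := by
    rintro _ ⟨v, hv, rfl⟩
    refine ⟨v, ?_⟩
    change sumAdjMul d (P v) - P (sumAdjMul d v) = A (P v)
    rw [hV v hv, map_smul, hA]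
  have hinj : Function.Injective (A.restrict hAX) := by
    rw [injective_iff_map_eq_zero]
    rintro ⟨_, v, hv, rfl⟩ hy
    have hy : A (P v) = 0 := congrArg Subtype.val hy
    exact Subtype.ext (hn _ (Submodule.starProjection_apply_mem _ _) (sub_eq_zero.1 hy))
  exact ⟨.of_injective _ hinj, LinearMap.finrank_le_finrank_of_injective hinj⟩

lemma eval_binary_form {i j : Fin d} (k : ℕ) (x : Fin (k + 1) → ℂ) (w : Fin d → ℂ) :
    MvPolynomial.eval w (∑ a : Fin (k + 1), .C (x a) * (.X i ^ (a : ℕ) * .X j ^ (k - a)))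
      = ∑ a : Fin (k + 1), x a * (w i ^ (a : ℕ) * w j ^ (k - a)) := by
  simp

lemma binary_form_eq_zero {i j : Fin d} (hij : i ≠ j) {k : ℕ} {x : Fin (k + 1) → ℂ}
    (h : ∑ a : Fin (k + 1), (.C (x a) * (.X i ^ (a : ℕ) * .X j ^ (k - a)) :
      MvPolynomial (Fin d) ℂ) = 0) : x = 0 := by
  funext b
  have h1 := congrArg
    (MvPolynomial.coeff (Finsupp.single i (b : ℕ) + Finsupp.single j (k - b))) h
  simp only [MvPolynomial.X_pow_eq_monomial, MvPolynomial.monomial_mul,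
    MvPolynomial.C_mul_monomial, MvPolynomial.coeff_sum, MvPolynomial.coeff_monomial,
    MvPolynomial.coeff_zero, mul_one] at h1
  rw [Finset.sum_eq_single b, if_pos rfl] at h1
  · exact h1
  · intro a _ hab
    refine if_neg fun h => hab (Fin.ext ?_)
    simpa [hij.symm] using DFunLike.congr_fun h i
  · simp

/-- If the projection onto a nonzero submodule commutes with `∑ j, M_j^* M_j` modulo finite rank
operators, then the submodule contains a nonzero homogeneous polynomial. -/
theorem exists_homogeneous_mem (hd : 2 ≤ d) {M : ClosedSubmodule ℂ (H2 d)} (hM : IsInvariant M)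
    (hM0 : M ≠ ⊥)
    (hS : CommutesModFiniteRank M.toSubmodule.starProjection (sumAdjMul d)) :
    ∃ n, ∃ q ∈ M.toSubmodule, q ≠ 0 ∧ sumAdjMul d q = (homEigenvalue d n : ℂ) • q := by
  by_contra! hcon
  obtain ⟨f, hfM, hf0⟩ : ∃ f ∈ M.toSubmodule, f ≠ 0 := by
    refine Submodule.exists_mem_ne_zero_of_ne_bot fun h => hM0 ?_
    exact ClosedSubmodule.toSubmodule_injective h
  obtain ⟨l, v, hlv⟩ : ∃ l v, ⟪homVec l v, f⟫_ℂ ≠ 0 := by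
    by_contra! h
    exact hf0 (eq_zero_of_inner_homVec h)
  set P := M.toSubmodule.starProjection
  set k := Module.finrank ℂ (sumAdjMul d * P - P * sumAdjMul d).range
  let i : Fin d := ⟨0, by lia⟩
  let j : Fin d := ⟨1, by lia⟩
  have hij : i ≠ j := by simp [i, j]
  obtain ⟨hfin, hrank⟩ := finrank_map_starProjection_le (n := k + l) hS
    fun q hq hSq => by_contra fun h0 => hcon (k + l) q hq h0 hSq
  set W := (Submodule.span ℂ (Set.range (homVec (d := d) (k + l)))).map (P : H2 d →ₗ[ℂ] H2 d)
  -- The `k + 1` elements `z_i ^ a * z_j ^ (k - a) * f` of `M`: since `W` has dimension at most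
  -- `k`, a nontrivial combination of them is orthogonal to `W`.
  let g (a : Fin (k + 1)) : H2 d := (mulCoord i ^ (a : ℕ)) ((mulCoord j ^ (k - a)) f)
  have hgM (a) : g a ∈ M.toSubmodule := mulCoord_pow_mem hM _ _ (mulCoord_pow_mem hM _ _ hfM)
  let G : (Fin (k + 1) → ℂ) →ₗ[ℂ] W :=
    (W.orthogonalProjectionOnto : H2 d →ₗ[ℂ] W) ∘ₗ Fintype.linearCombination ℂ g
  have hker : G.ker ≠ ⊥ := LinearMap.ker_ne_bot_of_finrank_lt (by
    rw [Module.finrank_fin_fun]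
    exact Nat.lt_succ_of_le hrank)
  obtain ⟨x, hx, hx0⟩ := Submodule.exists_mem_ne_zero_of_ne_bot hker
  have hxW : ∑ a, x a • g a ∈ Wᗮ := by
    rw [← Submodule.orthogonalProjectionOnto_eq_zero_iff]
    exact hx
  have hxM : ∑ a, x a • g a ∈ M.toSubmodule :=
    Submodule.sum_mem _ fun a _ => Submodule.smul_mem _ _ (hgM a)
  have hzero (w : Fin d → ℂ) : ⟪homVec (k + l) w, ∑ a, x a • g a⟫_ℂ = 0 := by
    have h1 : P (∑ a, x a • g a) = ∑ a, x a • g a := Submodule.starProjection_eq_self_iff.2 hxM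
    rw [← h1, ← Submodule.inner_starProjection_left_eq_right]
    exact hxW _ ⟨_, Submodule.subset_span ⟨w, rfl⟩, rfl⟩
  have heval (w : Fin d → ℂ) : ⟪homVec (k + l) w, ∑ a, x a • g a⟫_ℂ
      = (∑ a, x a * (w i ^ (a : ℕ) * w j ^ (k - a))) * ⟪homVec l w, f⟫_ℂ := by
    rw [inner_sum, Finset.sum_mul]
    refine Finset.sum_congr rfl fun a _ => ?_
    have ha : k + l = a + ((k - a) + l) := by lia
    rw [inner_smul_right, ha, inner_homVec_add_mulCoord_pow, inner_homVec_add_mulCoord_pow]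
    ring
  obtain ⟨p, hp⟩ := exists_eval_eq_inner_homVec l f
  have hprod : (∑ a : Fin (k + 1), (.C (x a) * (.X i ^ (a : ℕ) * .X j ^ (k - a)) :
      MvPolynomial (Fin d) ℂ)) * p = 0 := by
    refine MvPolynomial.funext fun w => ?_
    rw [map_mul, eval_binary_form, ← hp, ← heval, hzero, map_zero]
  rcases mul_eq_zero.1 hprod with h | h
  · exact hx0 (binary_form_eq_zero hij h)
  · exact hlv (by rw [hp, h, map_zero])

/-- If a submodule contains a nonzero homogeneous polynomial and the projection onto it commutes
with all the `M_j` modulo finite rank operators, then it has finite codimension: multiplication by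
the polynomial is injective and maps `H²` into the submodule, so it takes the complementary
projection to a finite rank commutator. -/
theorem isFiniteRank_one_sub_starProjection (hd : 2 ≤ d) {M : ClosedSubmodule ℂ (H2 d)}
    (hM : IsInvariant M)
    (hcomm : ∀ j, CommutesModFiniteRank M.toSubmodule.starProjection (mulCoord j))
    {n : ℕ} {f : H2 d} (hfM : f ∈ M.toSubmodule) (hf0 : f ≠ 0)
    (hf : sumAdjMul d f = (homEigenvalue d n : ℂ) • f) :
    IsFiniteRank (1 - M.toSubmodule.starProjection) := by
  set P := M.toSubmodule.starProjection
  obtain ⟨q, T, hT, hq, hTq, hTl⟩ := exists_multiplier n f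
  have hfq (z : Ball d) : f z = MvPolynomial.eval z.1.ofLp q := by
    rw [apply_eq_inner_homVec_of_eigenvector hd hf, hq]
  have hq0 : q ≠ 0 := by
    rintro rfl
    exact hf0 (by ext z; simp [hfq])
  -- Dividing `f` by `1 - ⟨z, w⟩` stays in `M` by a Neumann series, and gives `q * K(·, w)`.
  have hker (w : Ball d) : T (kerVec w) ∈ M.toSubmodule := by
    have h : T (kerVec w) - mulLin w.1 (T (kerVec w)) = f := by
      ext z
      rw [RKHS.coe_sub, Pi.sub_apply, mulLin_apply_apply, hTq, hfq, kerVec_apply]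
      linear_combination (MvPolynomial.eval z.1.ofLp q) * kernelFun_mul z w
    have hmem (m : ℕ) : (mulLin w.1.ofLp ^ m) f ∈ M.toSubmodule := by
      induction m with
      | zero => simpa using hfM
      | succ m ih =>
        rw [pow_succ', mul_apply_eq_comp]
        exact mulLin_mem hM _ ih
    exact M.isClosed.mem_of_tendsto (hasSum_mulLin_pow w h)
      (.of_forall fun s => Submodule.sum_mem _ fun m _ => hmem m)
  have hTM (g : H2 d) : T g ∈ M.toSubmodule := by
    have hspan : Submodule.span ℂ (Set.range (kerVec (d := d))) ≤
        M.toSubmodule.comap (T : H2 d →ₗ[ℂ] H2 d) := by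
      rw [Submodule.span_le]
      rintro _ ⟨w, rfl⟩
      exact hker w
    have hcl : IsClosed (T ⁻¹' (M.toSubmodule : Set (H2 d))) := M.isClosed.preimage T.continuous
    exact hcl.closure_subset_iff.2 hspan (dense_span_kerVec g)
  have hTinj (g : H2 d) (hg : T g = 0) : g = 0 := by
    refine eq_zero_of_inner_homVec fun l w => ?_
    obtain ⟨p, hp⟩ := exists_eval_eq_inner_homVec l g
    have hqp : q * p = 0 := MvPolynomial.funext fun w => by
      rw [map_mul, ← hp, ← hTl, hg, inner_zero_right, map_zero]
    rw [hp, (mul_eq_zero.1 hqp).resolve_left hq0, map_zero]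
  have hPT : P * T = T := by
    ext1 g
    exact Submodule.starProjection_eq_self_iff.2 (hTM g)
  have hTcomm : CommutesModFiniteRank P T :=
    .of_mem_adjoin (by rintro _ ⟨j, rfl⟩; exact hcomm j) hT
  rw [CommutesModFiniteRank, hPT] at hTcomm
  refine hTcomm.of_ker_le fun g hg => hTinj _ ?_
  have hg : T (P g) - T g = 0 := hg
  change T (g - P g) = 0
  rw [map_sub, ← neg_sub, hg, neg_zero]

end DruryArveson

end

theorem theorem1 (d : ℕ) (hd : 2 ≤ d)
    (M : ClosedSubmodule ℂ (DruryArveson.H2 d)) (hM : DruryArveson.IsInvariant M)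
    (hM0 : M ≠ ⊥) :
    DruryArveson.IsDContractive (DruryArveson.restrictedTuple M hM) ∧
      (DruryArveson.tupleRank (DruryArveson.restrictedTuple M hM) = ⊤ ↔
        ¬ FiniteDimensional ℂ (DruryArveson.H2 d ⧸ M.toSubmodule)) := by
  have hpos := DruryArveson.isDContractive_restrictedTuple hM
  refine ⟨hpos, ?_⟩
  rw [DruryArveson.tupleRank_eq_top_iff hpos, not_iff_not]
  refine ⟨fun h => ?_, DruryArveson.isFiniteRank_defectSq hM⟩
  obtain ⟨n, q, hqM, hq0, hq⟩ := DruryArveson.exists_homogeneous_mem hd hM hM0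
    (DruryArveson.commutesModFiniteRank_sumAdjMul hM h)
  exact DruryArveson.isFiniteRank_one_sub_starProjection_iff.1
    (DruryArveson.isFiniteRank_one_sub_starProjection hd hM
      (DruryArveson.commutesModFiniteRank_mulCoord hM h) hqM hq0 hq)
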